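/- Let $\alpha\in(0,1)$ and let $g$ be a probability density on $\mathbb R$ that is unimodal (nondecreasing on $(-\infty,0]$, nonincreasing on $[0,\infty)$), symmetric about $0$ and logconcave ($\log g$ is concave on the support $\{g>0\}$, which is convex). Let $G(x)=\int_{-\infty}^x g(t)\,dt$ be its cdf, $G^{-1}(p)=\inf\{x: G(x)\ge p\}$ and $d_0=G^{-1}\!\left(\frac1{1+\alpha}\right)$. For $\theta\ge 0$ let $X$ have density $g(x-\theta)$ under $P_\theta$. For the flat prior $1_{[0,\infty)}(\theta)$ and an observation $x$ with $m(x)=\int_0^\infty g(x-\theta)\,d\theta>0$, let $\pi(\theta\mid x)=g(x-\theta)1_{[0,\infty)}(\theta)/m(x)$ be the posterior density. The HPD credible interval of credibility $1-\alpha$ given $x$ is the interval $I(x)=[l(x),u(x)]\subseteq[0,\infty)$ with $\int_{l(x)}^{u(x)}\pi(\theta\mid x)\,d\theta=1-\alpha$ such that, for all $\theta\in I(x)$ and $\theta'\in[0,\infty)\setminus I(x)$, $\pi(\theta'\mid x)\le\pi(\theta\mid x)$, and $|\theta-x|\le|\theta'-x|$ whenever $\pi(\theta'\mid x)=\pi(\theta\mid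 x)$ (ties are resolved in favour of the values closest to $x$). For every $x$ with $m(x)>0$ this interval exists and is unique. For $x$ with $m(x)=0$, which have probability zero under every $P_\theta$ with $\theta\ge0$, $l(x)$ and $u(x)$ are arbitrary. Then the frequentist coverage $C(\theta)=P_\theta\big(l(X)\le\theta\le u(X)\big)$ attains its minimum over $\theta\in[0,\infty)$ at $\theta=2d_0$ (and $2d_0\ge 0$): $$C(\theta)\ \ge\ C(2d_0)\ \ge\ 1-\frac{3\alpha}{2}\qquad\text{for all }\theta\ge 0.$$ -/

import Mathlib

open MeasureTheory Set

noncomputable section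

namespace LowerBoundedLocation

/-- `g` is a probability density function on the real line. -/
structure IsPDF (g : ℝ → ℝ) : Prop where
  measurable : Measurable g
  nonneg : ∀ x, 0 ≤ g x
  integral_eq_one : ∫ x, g x = 1

/-- `g` is unimodal with a mode at `0`, in the weak sense (flat pieces are allowed). -/
def IsUnimodalAtZero (g : ℝ → ℝ) : Prop :=
  MonotoneOn g (Iic 0) ∧ AntitoneOn g (Ici 0)

/-- `g` is symmetric about `0`. -/
def IsSymmetric (g : ℝ → ℝ) : Prop :=
  ∀ x, g (-x) = g x

/-- `g` is logconcave: its support is convex and `log g` is concave there. -/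
def IsLogConcave (g : ℝ → ℝ) : Prop :=
  ConcaveOn ℝ {x | 0 < g x} (fun x => Real.log (g x))

/-- The law `P_θ` of `X`, with density `x ↦ g (x - θ)`. -/
def law (g : ℝ → ℝ) (θ : ℝ) : Measure ℝ :=
  volume.withDensity (fun x => ENNReal.ofReal (g (x - θ)))

/-- The cdf `G` of `X - θ`, that is, of the density `g`. -/
def G (g : ℝ → ℝ) (x : ℝ) : ℝ :=
  ∫ t in Iic x, g t

/-- The inverse cdf `G⁻¹` (the quantile function). -/
def invG (g : ℝ → ℝ) (p : ℝ) : ℝ :=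
  sInf {x | p ≤ G g x}

/-- The flat prior density truncated onto `[0, ∞)`. -/
def prior (θ : ℝ) : ℝ :=
  (Ici (0 : ℝ)).indicator (fun _ => 1) θ

/-- The marginal density of the observation under the flat prior on `[0, ∞)`. -/
def marginal (g : ℝ → ℝ) (x : ℝ) : ℝ :=
  ∫ θ, g (x - θ) * prior θ

/-- The posterior density of `θ` given `X = x`; it is meaningful when `0 < marginal g x`. -/
def posterior (g : ℝ → ℝ) (x θ : ℝ) : ℝ :=
  g (x - θ) * prior θ / marginal g x

/-- `[l, u]` is the HPD credible interval of credibility `1 - α` given `X = x`: it lies in the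
parameter space, has posterior probability exactly `1 - α`, and the posterior density at its points
is at least that at all other parameter values. Where the posterior density is flat, ties are
resolved in favour of the parameter values closest to `x`, the mode of the likelihood. (If `g` is
strictly decreasing in `|z|` on its support, then `tie` adds nothing.) -/
structure IsHPDInterval (g : ℝ → ℝ) (α x l u : ℝ) : Prop where
  subset : Icc l u ⊆ Ici 0
  credibility : ∫ θ in Icc l u, posterior g x θ = 1 - α
  highest : ∀ θ ∈ Icc l u, ∀ θ' ∈ Ici (0 : ℝ) \ Icc l u, posterior g x θ' ≤ posterior g x θ
  tie : ∀ θ ∈ Icc l u, ∀ θ' ∈ Ici (0 : ℝ) \ Icc l u,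
    posterior g x θ' = posterior g x θ → |θ - x| ≤ |θ' - x|

/-- The frequentist coverage `P_θ (l X ≤ θ ≤ u X)` of the interval estimator `[l X, u X]`. -/
def coverage (g l u : ℝ → ℝ) (θ : ℝ) : ℝ :=
  (law g θ).real {x | θ ∈ Icc (l x) (u x)}

end LowerBoundedLocation

end

/-! The HPD interval at `x` consists of the parameters `θ ≥ 0` within some distance `r` of `x`. Thus
`θ` is covered at `x = t + θ` exactly when the parameters at distance at most `|t|` from `x` have
posterior mass at most `1 - α` (`IsHPDInterval.mem_iff`). For `t ≥ 0` this reads `2 G t - 1 ≤ (1 -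
α) G (t + θ)`. For `t = -s` with `2 s ≥ θ` the interval is cut at `0` and the condition is `α G (θ -
s) ≤ G (-s)`. Coverage is then a matter of cdf values at the two limits of `t`.

At `θ = 2d`, with `d = d₀` and `G (-d) = α G d`, the lower limit is exactly `-d`. It is sharp by a
strict likelihood ratio argument (`IsPDF.tail_lt`). The upper limit is `a`, where `2 G a - 1 = (1 -
α) G (a + 2 d)`. So the coverage at `2d` is at most `G a + G d - 1`, and it remains to bound every
other coverage below by this number.

For `θ ≥ 2d` all `t ∈ [-d, a]` are covered. For `θ < 2d` the upper limit may shrink, but the lower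
one extends to some `-b` with `b ≥ d`. The gain `G b - G d` pays for the loss: the likelihood ratio
of the shift by `2d` is at most `g (2d) / g 0` on the right of `0`, and `G d = 1 / (1 + α)` forces
this to be at most `2 α / (1 - α)` (`IsPDF.density_ratio_le`, `IsPDF.upper_tail_change_le`). The
numerical bound follows from logconcavity of `G`, which gives `G (-2d) ≤ 2 G (-d) ^ 2`. -/

namespace LowerBoundedLocation

variable {g : ℝ → ℝ}

/-! ### The cdf of a symmetric unimodal density -/

lemma IsPDF.integrable (h : IsPDF g) : Integrable g :=
  integrable_of_integral_eq_one h.integral_eq_one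

lemma IsPDF.intervalIntegrable (h : IsPDF g) (a b : ℝ) : IntervalIntegrable g volume a b :=
  h.integrable.intervalIntegrable

lemma IsPDF.intervalIntegrable_shift (h : IsPDF g) (c a b : ℝ) :
    IntervalIntegrable (fun t => g (t + c)) volume a b :=
  (h.integrable.comp_add_right c).intervalIntegrable

lemma IsPDF.G_sub (h : IsPDF g) (a b : ℝ) : G g b - G g a = ∫ t in a..b, g t :=
  intervalIntegral.integral_Iic_sub_Iic h.integrable.integrableOn h.integrable.integrableOn

lemma IsPDF.G_shift_sub (h : IsPDF g) (c a b : ℝ) :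
    G g (b + c) - G g (a + c) = ∫ t in a..b, g (t + c) := by
  rw [h.G_sub, intervalIntegral.integral_comp_add_right]

lemma IsPDF.G_continuous (h : IsPDF g) : Continuous (G g) := by
  have : G g = fun x => G g 0 + ∫ t in (0 : ℝ)..x, g t := by
    funext x
    rw [← h.G_sub]
    ring
  rw [this]
  exact continuous_const.add
    (intervalIntegral.continuous_primitive (fun a b => h.intervalIntegrable a b) 0)

lemma IsPDF.G_mono (h : IsPDF g) : Monotone (G g) := fun _ _ hab =>
  setIntegral_mono_set h.integrable.integrableOn
    (Filter.Eventually.of_forall h.nonneg) (Iic_subset_Iic.2 hab).eventuallyLE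

lemma IsPDF.G_nonneg (h : IsPDF g) (x : ℝ) : 0 ≤ G g x :=
  integral_nonneg h.nonneg

lemma IsPDF.G_le_one (h : IsPDF g) (x : ℝ) : G g x ≤ 1 := by
  rw [← h.integral_eq_one]
  exact setIntegral_le_integral h.integrable (Filter.Eventually.of_forall h.nonneg)

lemma IsPDF.G_neg (h : IsPDF g) (hs : IsSymmetric g) (x : ℝ) : G g (-x) = 1 - G g x := by
  have h1 : G g (-x) = ∫ t in Ioi x, g t := by
    have := integral_comp_neg_Iic (-x) g
    rw [neg_neg] at this
    rw [← this]
    simp only [G, hs _]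
  have h2 := intervalIntegral.integral_Iic_add_Ioi (b := x) (μ := volume)
    h.integrable.integrableOn h.integrable.integrableOn
  rw [h.integral_eq_one] at h2
  rw [h1]
  unfold G
  linarith

lemma IsPDF.G_zero (h : IsPDF g) (hs : IsSymmetric g) : G g 0 = 1 / 2 := by
  have := h.G_neg hs 0
  rw [neg_zero] at this
  linarith

lemma IsPDF.G_tendsto_atTop (h : IsPDF g) : Filter.Tendsto (G g) Filter.atTop (nhds 1) := by
  rw [← h.integral_eq_one, ← setIntegral_univ]
  have := tendsto_setIntegral_of_monotone (μ := volume) (f := g) (s := fun x : ℝ => Iic x)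
    (fun _ => measurableSet_Iic) (fun a b hab => Iic_subset_Iic.2 hab)
    h.integrable.integrableOn
  rwa [iUnion_Iic] at this

lemma IsPDF.exists_G_eq (h : IsPDF g) {p : ℝ} {a : ℝ} (ha : G g a ≤ p) (hp : p < 1) :
    ∃ x, a ≤ x ∧ G g x = p := by
  obtain ⟨b, hb, hab⟩ := ((h.G_tendsto_atTop.eventually (lt_mem_nhds hp)).and
    (Filter.eventually_ge_atTop a)).exists
  obtain ⟨x, hx, hx'⟩ := intermediate_value_Icc hab h.G_continuous.continuousOn ⟨ha, hb.le⟩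
  exact ⟨x, hx.1, hx'⟩

lemma IsUnimodalAtZero.le_of_abs_le (hu : IsUnimodalAtZero g) (hs : IsSymmetric g) {s t : ℝ}
    (hst : |s| ≤ |t|) : g t ≤ g s := by
  have habs : ∀ x, g |x| = g x := fun x => by
    rcases abs_choice x with hx | hx <;> rw [hx]
    exact hs x
  rw [← habs s, ← habs t]
  exact hu.2 (abs_nonneg s) (abs_nonneg t) hst

lemma IsPDF.G_lt_of_pos (h : IsPDF g) (hu : IsUnimodalAtZero g) (hs : IsSymmetric g)
    {a b t : ℝ} (hab : a < b) (ht : 0 < g t) (ha : |a| ≤ |t|) (hb : |b| ≤ |t|) :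
    G g a < G g b := by
  rw [← sub_pos, h.G_sub]
  refine intervalIntegral.intervalIntegral_pos_of_pos_on (h.intervalIntegrable a b) ?_ hab
  intro x hx
  refine ht.trans_le (hu.le_of_abs_le hs (abs_le.2 ⟨?_, ?_⟩))
  · linarith [(abs_le.1 ha).1, hx.1]
  · linarith [(abs_le.1 hb).2, hx.2]

lemma IsPDF.pos_of_G_neg_pos (h : IsPDF g) (hu : IsUnimodalAtZero g) (hs : IsSymmetric g)
    {b : ℝ} (hb : 0 ≤ b) (hG : 0 < G g (-b)) : 0 < g b := by
  refine (h.nonneg b).lt_of_ne fun h0 => hG.ne' ?_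
  unfold G
  refine setIntegral_eq_zero_of_forall_eq_zero fun t ht => ?_
  refine le_antisymm ?_ (h.nonneg t)
  rw [h0]
  refine hu.le_of_abs_le hs ?_
  rw [abs_of_nonneg hb, le_abs]
  right
  linarith [mem_Iic.1 ht]

lemma IsPDF.pos_of_G_lt_one (h : IsPDF g) (hu : IsUnimodalAtZero g) (hs : IsSymmetric g)
    {b : ℝ} (hb : 0 ≤ b) (hG : G g b < 1) : 0 < g b :=
  h.pos_of_G_neg_pos hu hs hb (by rw [h.G_neg hs]; linarith)

lemma IsPDF.pos_zero (h : IsPDF g) (hu : IsUnimodalAtZero g) (hs : IsSymmetric g) : 0 < g 0 :=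
  h.pos_of_G_lt_one hu hs le_rfl (by rw [h.G_zero hs]; norm_num)

/-! ### Logconcavity, likelihood ratios and the quantile -/

/-- The shift of a logconcave function has a monotone likelihood ratio. -/
lemma IsLogConcave.mul_shift_le (hl : IsLogConcave g) (h0 : ∀ x, 0 ≤ g x) {p r h : ℝ}
    (hpr : p ≤ r) (hh : 0 ≤ h) : g p * g (r + h) ≤ g (p + h) * g r := by
  rcases (h0 p).eq_or_lt with hp | hp
  · rw [← hp, zero_mul]
    exact mul_nonneg (h0 _) (h0 _)
  rcases (h0 (r + h)).eq_or_lt with hr | hr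
  · rw [← hr, mul_zero]
    exact mul_nonneg (h0 _) (h0 _)
  rcases hh.eq_or_lt with rfl | hh
  · simp
  have hd : 0 < r + h - p := by linarith
  set w := h / (r + h - p) with hw
  have hw0 : 0 ≤ w := by positivity
  have hw1 : w ≤ 1 := by
    -- `p + h` and `r` are convex combinations of `p` and `r + h` with the two weights exchanged, so
    -- the two concavity inequalities add up to the claim.
    rw [hw, div_le_one hd]
    linarith
  have hwd : w * (r + h - p) = h := div_mul_cancel₀ _ hd.ne'
  have e1 : w • p + (1 - w) • (r + h) = r := by
    simp only [smul_eq_mul]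
    linear_combination -hwd
  have e2 : (1 - w) • p + w • (r + h) = p + h := by
    simp only [smul_eq_mul]
    linear_combination hwd
  have m1 := hl.1 hp hr hw0 (sub_nonneg.2 hw1) (by ring)
  have m2 := hl.1 hp hr (sub_nonneg.2 hw1) hw0 (by ring)
  have c1 := hl.2 hp hr hw0 (sub_nonneg.2 hw1) (by ring)
  have c2 := hl.2 hp hr (sub_nonneg.2 hw1) hw0 (by ring)
  rw [e1] at m1 c1
  rw [e2] at m2 c2
  have m1' : 0 < g r := m1
  have m2' : 0 < g (p + h) := m2
  simp only [smul_eq_mul] at c1 c2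
  rw [← Real.log_le_log_iff (mul_pos hp hr) (mul_pos m2' m1'), Real.log_mul hp.ne' hr.ne',
    Real.log_mul m2'.ne' m1'.ne']
  linarith

/-- To the right of `p`, the shifted density is at most the likelihood ratio at `p` times the
density. -/
lemma IsPDF.mul_G_shift_sub_le (h : IsPDF g) (hl : IsLogConcave g) {p a b c : ℝ}
    (hpa : p ≤ a) (hab : a ≤ b) (hc : 0 ≤ c) :
    g p * (G g (b + c) - G g (a + c)) ≤ g (p + c) * (G g b - G g a) := by
  rw [h.G_shift_sub, h.G_sub, ← intervalIntegral.integral_const_mul,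
    ← intervalIntegral.integral_const_mul]
  refine intervalIntegral.integral_mono_on hab ((h.intervalIntegrable_shift c a b).const_mul _)
    ((h.intervalIntegrable a b).const_mul _) fun x hx => ?_
  exact hl.mul_shift_le h.nonneg (hpa.trans hx.1) hc

lemma G_shift (c p : ℝ) : G g (p + c) = ∫ t in Iic p, g (t + c) := by
  have h2 : ∫ t in Iic p, g (t + c) = ∫ t, (Iic (p + c)).indicator g (t + c) := by
    rw [← integral_indicator measurableSet_Iic]
    congr 1
    funext t
    simp only [indicator, mem_Iic, add_le_add_iff_right]
  rw [h2, integral_add_right_eq_self (fun t => (Iic (p + c)).indicator g t),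
    integral_indicator measurableSet_Iic]
  rfl

lemma IsPDF.mul_G_le (h : IsPDF g) (hl : IsLogConcave g) {p c : ℝ} (hc : 0 ≤ c) :
    g (p + c) * G g p ≤ g p * G g (p + c) := by
  rw [G_shift, G, ← integral_const_mul, ← integral_const_mul]
  refine setIntegral_mono_on (h.integrable.integrableOn.const_mul _)
    ((h.integrable.comp_add_right c).integrableOn.const_mul _) measurableSet_Iic fun x hx => ?_
  have := hl.mul_shift_le h.nonneg (mem_Iic.1 hx) hc
  linarith

/-- The cdf of a logconcave density has a monotone likelihood ratio under shifts. -/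
lemma IsPDF.G_mul_shift_le (h : IsPDF g) (hl : IsLogConcave g) {p q c : ℝ} (hgp : 0 < g p)
    (hpq : p ≤ q) (hc : 0 ≤ c) : G g p * G g (q + c) ≤ G g (p + c) * G g q := by
  have h1 := h.mul_G_shift_sub_le hl le_rfl hpq hc
  have h2 := h.mul_G_le hl (p := p) hc
  have h3 : 0 ≤ G g q - G g p := sub_nonneg.2 (h.G_mono hpq)
  -- The density ratio at `p` bounds the ratio of masses from above on `[p, q]` and from below on
  -- `(-∞, p]`. Eliminating it leaves a statement about `G` alone, times `g p`.
  have h4 := mul_le_mul_of_nonneg_left h1 (h.G_nonneg p)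
  have h5 := mul_le_mul_of_nonneg_right h2 h3
  have : g p * (G g p * G g (q + c)) ≤ g p * (G g (p + c) * G g q) := by linarith
  exact le_of_mul_le_mul_left this hgp

/-- Translating an interval away from the mode reduces its probability. -/
lemma IsPDF.G_shift_sub_le (h : IsPDF g) (hu : IsUnimodalAtZero g) {a b c : ℝ}
    (ha : 0 ≤ a) (hab : a ≤ b) (hc : 0 ≤ c) :
    G g (b + c) - G g (a + c) ≤ G g b - G g a := by
  rw [h.G_shift_sub, h.G_sub]
  refine intervalIntegral.integral_mono_on hab (h.intervalIntegrable_shift c a b)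
    (h.intervalIntegrable a b) fun x hx => ?_
  have hx0 : 0 ≤ x := ha.trans hx.1
  exact hu.2 hx0 (add_nonneg hx0 hc) (by linarith)

lemma IsPDF.invG_spec (h : IsPDF g) {p : ℝ} (hp : G g 0 < p) (hp1 : p < 1) :
    0 < invG g p ∧ G g (invG g p) = p := by
  obtain ⟨b, hb, hGb⟩ := h.exists_G_eq hp.le hp1
  have hlow : ∀ x ∈ {x | p ≤ G g x}, 0 ≤ x := by
    intro x hx
    by_contra! hx0
    exact absurd (hx.trans (h.G_mono hx0.le)) (not_le.2 hp)
  -- Nonempty and bounded below, the set has a genuine infimum, so `sInf` does not take its default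
  -- value.
  have hbdd : BddBelow {x | p ≤ G g x} := ⟨0, hlow⟩
  have hmem : invG g p ∈ {x | p ≤ G g x} :=
    (isClosed_le continuous_const h.G_continuous).csInf_mem ⟨b, hGb.ge⟩ hbdd
  have hle : invG g p ≤ b := csInf_le hbdd hGb.ge
  have hG : G g (invG g p) = p := le_antisymm ((h.G_mono hle).trans hGb.le) hmem
  refine ⟨(hlow _ hmem).lt_of_ne fun h0 => ?_, hG⟩
  rw [← h0] at hG
  exact hp.ne hG

/-! ### The posterior in terms of the cdf -/

lemma mul_prior_eq_indicator (f : ℝ → ℝ) :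
    (fun θ => f θ * prior θ) = (Ici (0 : ℝ)).indicator f := by
  funext θ
  by_cases hθ : θ ∈ Ici (0 : ℝ) <;> simp [prior, hθ]

lemma marginal_eq_G (x : ℝ) : marginal g x = G g x := by
  unfold marginal
  rw [mul_prior_eq_indicator (fun θ => g (x - θ))]
  have : (Ici (0 : ℝ)).indicator (fun θ => g (x - θ))
      = fun θ => (Iic x).indicator g (x - θ) := by
    funext θ
    simp only [indicator, mem_Ici, mem_Iic, sub_le_self_iff]
  rw [this, integral_sub_left_eq_self (fun t => (Iic x).indicator g t),
    integral_indicator measurableSet_Iic]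
  rfl

lemma posterior_of_nonneg (x : ℝ) {θ : ℝ} (hθ : 0 ≤ θ) :
    posterior g x θ = g (x - θ) / G g x := by
  simp [posterior, prior, marginal_eq_G, mem_Ici.2 hθ]

lemma posterior_of_neg (x : ℝ) {θ : ℝ} (hθ : θ < 0) : posterior g x θ = 0 := by
  simp [posterior, prior, hθ]

lemma integral_posterior {x : ℝ} (hx : 0 < G g x) : ∫ θ, posterior g x θ = 1 := by
  unfold posterior
  rw [integral_div]
  change marginal g x / marginal g x = 1
  rw [marginal_eq_G, div_self hx.ne']

lemma IsPDF.posterior_nonneg (h : IsPDF g) (x θ : ℝ) : 0 ≤ posterior g x θ := by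
  rcases le_or_gt 0 θ with hθ | hθ
  · rw [posterior_of_nonneg x hθ]
    exact div_nonneg (h.nonneg _) (h.G_nonneg _)
  · rw [posterior_of_neg x hθ]

lemma IsPDF.integral_posterior_Icc (h : IsPDF g) (x : ℝ) {l u : ℝ} (hl : 0 ≤ l) (hlu : l ≤ u) :
    ∫ θ in Icc l u, posterior g x θ = (G g (x - l) - G g (x - u)) / G g x := by
  rw [setIntegral_congr_fun measurableSet_Icc
    (fun θ hθ => posterior_of_nonneg x (hl.trans hθ.1)), integral_div, h.G_sub,
    integral_Icc_eq_integral_Ioc, ← intervalIntegral.integral_of_le hlu,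
    intervalIntegral.integral_comp_sub_left]

/-! ### Uniqueness of the HPD interval -/

namespace IsHPDInterval

variable {α x l u l' u' : ℝ}

lemma lt (hα1 : α < 1) (hI : IsHPDInterval g α x l u) : l < u := by
  by_contra! hul
  have := hI.credibility
  rw [Measure.restrict_eq_zero.2 (by simp [hul]), integral_zero_measure] at this
  linarith

lemma left_nonneg (hα1 : α < 1) (hI : IsHPDInterval g α x l u) : 0 ≤ l :=
  hI.subset (left_mem_Icc.2 (hI.lt hα1).le)

lemma G_sub_eq (h : IsPDF g) (hα1 : α < 1) (hx : 0 < G g x) (hI : IsHPDInterval g α x l u) :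
    G g (x - l) - G g (x - u) = (1 - α) * G g x := by
  have := hI.credibility
  rwa [h.integral_posterior_Icc x (hI.left_nonneg hα1) (hI.lt hα1).le, div_eq_iff hx.ne'] at this

/-- A zero of the posterior inside the interval would force it to vanish outside, and the interval
would have credibility `1` rather than `1 - α`. -/
lemma density_pos (h : IsPDF g) (hα0 : 0 < α) (hx : 0 < G g x) (hI : IsHPDInterval g α x l u)
    {θ : ℝ} (hθ : θ ∈ Icc l u) : 0 < g (x - θ) := by
  refine (h.nonneg _).lt_of_ne fun h0 => ?_
  have hz : posterior g x θ = 0 := by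
    rw [posterior_of_nonneg x (hI.subset hθ), ← h0, zero_div]
  have hall : ∀ θ', θ' ∉ Icc l u → posterior g x θ' = 0 := by
    intro θ' hθ'
    rcases le_or_gt 0 θ' with h1 | h1
    · exact le_antisymm ((hI.highest θ hθ θ' ⟨h1, hθ'⟩).trans hz.le) (h.posterior_nonneg _ _)
    · exact posterior_of_neg x h1
  have := hI.credibility
  rw [setIntegral_eq_integral_of_forall_compl_eq_zero hall, integral_posterior hx] at this
  linarith

lemma eq_of_nested (h : IsPDF g) (hα0 : 0 < α) (hα1 : α < 1) (hx : 0 < G g x)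
    (hI : IsHPDInterval g α x l u) (hJ : IsHPDInterval g α x l' u') (hl : l' ≤ l) (hu : u ≤ u') :
    l = l' ∧ u = u' := by
  have hlu := hI.lt hα1
  have e1 := hI.G_sub_eq h hα1 hx
  have e2 := hJ.G_sub_eq h hα1 hx
  have m1 : G g (x - l) ≤ G g (x - l') := h.G_mono (by linarith)
  have m2 : G g (x - u') ≤ G g (x - u) := h.G_mono (by linarith)
  have key : ∀ a b, l' ≤ a → b ≤ u' → a < b → G g (x - b) < G g (x - a) := by
    intro a b ha hb hab
    rw [← sub_pos, h.G_sub]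
    refine intervalIntegral.intervalIntegral_pos_of_pos_on (h.intervalIntegrable _ _) ?_
      (by linarith)
    intro t ht
    have := hJ.density_pos h hα0 hx (θ := x - t)
      ⟨by linarith [ht.2], by linarith [ht.1]⟩
    rwa [sub_sub_cancel] at this
  constructor
  · by_contra hne
    have := key l' l le_rfl (by linarith) (lt_of_le_of_ne hl (Ne.symm hne))
    linarith
  · by_contra hne
    have := key u u' (by linarith) le_rfl (lt_of_le_of_ne hu hne)
    linarith

/-- If each interval had points outside the other, such points would tie in density and then in
distance to `x`. Every point of `[l, u]` left of `l'` would be the reflection of `u'` in `x`, yet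
there is more than one such point. -/
lemma not_overlap (hα1 : α < 1)
    (hI : IsHPDInterval g α x l u) (hJ : IsHPDInterval g α x l' u') (hl : l < l') : u' ≤ u := by
  by_contra! hu
  have hlu := hI.lt hα1
  have hlu' := hJ.lt hα1
  have hl0 := hI.left_nonneg hα1
  have key : ∀ θ, l ≤ θ → θ < l' → θ ≤ u → θ = 2 * x - u' := by
    intro θ h1 h2 h3
    have mI : θ ∈ Icc l u := ⟨h1, h3⟩
    have mJ : u' ∈ Icc l' u' := right_mem_Icc.2 hlu'.le
    have nI : u' ∈ Ici (0 : ℝ) \ Icc l u := ⟨hJ.subset mJ, fun hm => by linarith [hm.2]⟩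
    have nJ : θ ∈ Ici (0 : ℝ) \ Icc l' u' := ⟨hI.subset mI, fun hm => by linarith [hm.1]⟩
    have e := le_antisymm (hI.highest _ mI _ nI) (hJ.highest _ mJ _ nJ)
    have d := le_antisymm (hI.tie _ mI _ nI e) (hJ.tie _ mJ _ nJ e.symm)
    rcases abs_eq_abs.1 d with d | d
    · linarith
    · linarith
  have hm : l < min l' u := lt_min hl hlu
  obtain ⟨θ, h1, h2⟩ := exists_between hm
  have a1 := key l le_rfl hl hlu.le
  have a2 := key θ h1.le (h2.trans_le (min_le_left _ _)) (h2.trans_le (min_le_right _ _)).le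
  linarith

lemma unique (h : IsPDF g) (hα0 : 0 < α) (hα1 : α < 1) (hx : 0 < G g x)
    (hI : IsHPDInterval g α x l u) (hJ : IsHPDInterval g α x l' u') : l = l' ∧ u = u' := by
  rcases lt_trichotomy l l' with hl | hl | hl
  · obtain ⟨h1, h2⟩ := hJ.eq_of_nested h hα0 hα1 hx hI hl.le (hI.not_overlap hα1 hJ hl)
    exact ⟨h1.symm, h2.symm⟩
  · rcases le_total u u' with hu | hu
    · exact hI.eq_of_nested h hα0 hα1 hx hJ hl.ge hu
    · obtain ⟨h1, h2⟩ := hJ.eq_of_nested h hα0 hα1 hx hI hl.le hu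
      exact ⟨h1.symm, h2.symm⟩
  · exact hI.eq_of_nested h hα0 hα1 hx hJ hl.le (hJ.not_overlap hα1 hI hl)

end IsHPDInterval

/-! ### Existence of the HPD interval and a criterion for membership -/

lemma IsPDF.exists_radius (h : IsPDF g) (hs : IsSymmetric g) {α x : ℝ} (hα0 : 0 < α)
    (hα1 : α < 1) (hx : 0 < G g x) :
    ∃ r, 0 ≤ r ∧ -x ≤ r ∧ G g (min r x) - G g (-r) = (1 - α) * G g x := by
  obtain ⟨R, hGR, hR⟩ := ((h.G_tendsto_atTop.eventually
    (lt_mem_nhds (show 1 - α * G g x < 1 by nlinarith))).and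
      (Filter.eventually_ge_atTop |x|)).exists
  have hcont : Continuous fun r => G g (min r x) - G g (-r) :=
    (h.G_continuous.comp (continuous_id.min continuous_const)).sub
      (h.G_continuous.comp continuous_neg)
  -- The smallest radius is the distance from `x` to `[0, ∞)`, where the mass is zero. At `R` the
  -- missing mass `1 - G R` is less than `α G x`.
  have hle : max 0 (-x) ≤ R := (max_le (abs_nonneg x) (neg_le_abs x)).trans hR
  obtain ⟨r, hr, hr'⟩ := intermediate_value_Icc hle hcont.continuousOn
    (show (1 - α) * G g x ∈ Icc _ _ from by
      constructor
      · have : G g (min (max 0 (-x)) x) - G g (-max 0 (-x)) = 0 := by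
          rcases le_total 0 x with h0 | h0
          · rw [max_eq_left (by linarith), min_eq_left h0, neg_zero, sub_self]
          · rw [max_eq_right (by linarith), min_eq_right (by linarith), neg_neg, sub_self]
        rw [this]
        nlinarith
      · rw [min_eq_right ((le_abs_self x).trans hR), h.G_neg hs]
        linarith)
  exact ⟨r, (le_max_left _ _).trans hr.1, (le_max_right _ _).trans hr.1, hr'⟩

lemma IsPDF.isHPDInterval_of_radius (h : IsPDF g) (hu : IsUnimodalAtZero g)
    (hs : IsSymmetric g) {α x r : ℝ} (hx : 0 < G g x) (hr0 : 0 ≤ r) (hr : -x ≤ r)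
    (hG : G g (min r x) - G g (-r) = (1 - α) * G g x) :
    IsHPDInterval g α x (max 0 (x - r)) (x + r) := by
  have hmem : ∀ θ, 0 ≤ θ → (θ ∈ Icc (max 0 (x - r)) (x + r) ↔ |θ - x| ≤ r) := by
    intro θ hθ
    rw [mem_Icc, max_le_iff, abs_le]
    constructor
    · rintro ⟨⟨_, h1⟩, h2⟩
      constructor <;> linarith
    · rintro ⟨h1, h2⟩
      exact ⟨⟨hθ, by linarith⟩, by linarith⟩
  have hnn : ∀ θ ∈ Icc (max 0 (x - r)) (x + r), 0 ≤ θ := fun θ hθ =>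
    (le_max_left _ _).trans hθ.1
  have hcloser : ∀ θ ∈ Icc (max 0 (x - r)) (x + r),
      ∀ θ' ∈ Ici (0 : ℝ) \ Icc (max 0 (x - r)) (x + r), |θ - x| ≤ |θ' - x| := by
    intro θ hθ θ' hθ'
    have h1 := (hmem θ (hnn θ hθ)).1 hθ
    have h2 : ¬ |θ' - x| ≤ r := fun h3 => hθ'.2 ((hmem θ' hθ'.1).2 h3)
    exact h1.trans (not_le.1 h2).le
  refine ⟨hnn, ?_, ?_, fun θ hθ θ' hθ' _ => hcloser θ hθ θ' hθ'⟩
  · rw [h.integral_posterior_Icc x (le_max_left _ _) (max_le (by linarith) (by linarith)),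
      div_eq_iff hx.ne', ← hG]
    congr 2
    · rcases le_total r x with h1 | h1
      · rw [max_eq_right (by linarith), min_eq_left h1, sub_sub_cancel]
      · rw [max_eq_left (by linarith), min_eq_right h1, sub_zero]
    · ring
  · intro θ hθ θ' hθ'
    rw [posterior_of_nonneg x (hnn θ hθ), posterior_of_nonneg x hθ'.1]
    refine div_le_div_of_nonneg_right (hu.le_of_abs_le hs ?_) hx.le
    rw [abs_sub_comm x, abs_sub_comm x]
    exact hcloser θ hθ θ' hθ'

lemma IsPDF.existsUnique_isHPDInterval (h : IsPDF g) (hu : IsUnimodalAtZero g)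
    (hs : IsSymmetric g) {α x : ℝ} (hα0 : 0 < α) (hα1 : α < 1) (hx : 0 < G g x) :
    ∃! I : ℝ × ℝ, IsHPDInterval g α x I.1 I.2 := by
  obtain ⟨r, hr0, hr, hG⟩ := h.exists_radius hs hα0 hα1 hx
  have hI := h.isHPDInterval_of_radius hu hs hx hr0 hr hG
  refine ⟨(_, _), hI, fun J hJ => ?_⟩
  obtain ⟨h1, h2⟩ := hJ.unique h hα0 hα1 hx hI
  exact Prod.ext h1 h2

/-- Membership in the HPD interval, expressed by the cdf: the interval contains `θ` iff the
parameter values at least as close to the observation as `θ` have posterior probability at most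
`1 - α`. -/
lemma IsHPDInterval.mem_iff (h : IsPDF g) (hu : IsUnimodalAtZero g) (hs : IsSymmetric g)
    {α θ t l u : ℝ} (hα0 : 0 < α) (hα1 : α < 1) (hθ : 0 ≤ θ) (ht : 0 < g t)
    (hx : 0 < G g (t + θ)) (hI : IsHPDInterval g α (t + θ) l u) :
    θ ∈ Icc l u ↔ G g (min |t| (t + θ)) - G g (-|t|) ≤ (1 - α) * G g (t + θ) := by
  obtain ⟨r, hr0, hr, hG⟩ := h.exists_radius hs hα0 hα1 hx
  obtain ⟨rfl, rfl⟩ := hI.unique h hα0 hα1 hx (h.isHPDInterval_of_radius hu hs hx hr0 hr hG)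
  have hmem : θ ∈ Icc (max 0 (t + θ - r)) (t + θ + r) ↔ |t| ≤ r := by
    rw [mem_Icc, max_le_iff, abs_le]
    constructor
    · rintro ⟨⟨_, h1⟩, h2⟩
      constructor <;> linarith
    · rintro ⟨h1, h2⟩
      exact ⟨⟨hθ, by linarith⟩, by linarith⟩
  rw [hmem, ← hG]
  constructor
  · intro htr
    exact sub_le_sub (h.G_mono (min_le_min_right _ htr)) (h.G_mono (neg_le_neg htr))
  · intro hle
    by_contra! hrt
    have h1 : G g (-|t|) < G g (-r) :=
      h.G_lt_of_pos hu hs (neg_lt_neg hrt) ht (by simp)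
        (by rw [abs_neg, abs_of_nonneg hr0]; exact hrt.le)
    have h2 : G g (min r (t + θ)) ≤ G g (min |t| (t + θ)) :=
      h.G_mono (min_le_min_right _ hrt.le)
    linarith

/-! ### Coverage bounds from intervals for `X - θ` -/

lemma IsPDF.isFiniteMeasure_law (h : IsPDF g) (θ : ℝ) : IsFiniteMeasure (law g θ) :=
  isFiniteMeasure_withDensity_ofReal (h.integrable.comp_sub_right θ).2

lemma IsPDF.law_real_Icc (h : IsPDF g) (θ : ℝ) {a b : ℝ} (hab : a ≤ b) :
    (law g θ).real (Icc (a + θ) (b + θ)) = G g b - G g a := by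
  have h1 : IntegrableOn (fun x => g (x - θ)) (Icc (a + θ) (b + θ)) :=
    (h.integrable.comp_sub_right θ).integrableOn
  rw [Measure.real, law, withDensity_apply _ measurableSet_Icc,
    ← ofReal_integral_eq_lintegral_ofReal h1 (Filter.Eventually.of_forall fun x => h.nonneg _),
    ENNReal.toReal_ofReal (integral_nonneg fun x => h.nonneg _), integral_Icc_eq_integral_Ioc,
    ← intervalIntegral.integral_of_le (by linarith), intervalIntegral.integral_comp_sub_right,
    h.G_sub, add_sub_cancel_right, add_sub_cancel_right]

/-- Allows upper bounds on coverage to ignore observations with `g (x - θ) = 0`, where the cdf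
criterion for membership is unavailable. -/
lemma IsPDF.law_density_eq_zero (h : IsPDF g) (θ : ℝ) : law g θ {x | g (x - θ) = 0} = 0 := by
  have hm : MeasurableSet {x | g (x - θ) = 0} :=
    (h.measurable.comp (measurable_id.sub_const θ)) (measurableSet_singleton 0)
  rw [law, withDensity_apply _ hm, setLIntegral_congr_fun hm (g := fun _ => 0)]
  · simp
  · intro x hx
    have hx0 : g (x - θ) = 0 := hx
    simp [hx0]

lemma IsPDF.le_coverage (h : IsPDF g) {l u : ℝ → ℝ} {θ a b : ℝ} (hab : a ≤ b)
    (hc : ∀ t ∈ Icc a b, θ ∈ Icc (l (t + θ)) (u (t + θ))) :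
    G g b - G g a ≤ coverage g l u θ := by
  have := h.isFiniteMeasure_law θ
  rw [← h.law_real_Icc θ hab]
  refine measureReal_mono fun x hx => ?_
  have := hc (x - θ) ⟨by linarith [hx.1], by linarith [hx.2]⟩
  rwa [sub_add_cancel] at this

lemma IsPDF.coverage_le (h : IsPDF g) {l u : ℝ → ℝ} {θ a b : ℝ} (hab : a ≤ b)
    (hc : ∀ t, 0 < g t → θ ∈ Icc (l (t + θ)) (u (t + θ)) → t ∈ Icc a b) :
    coverage g l u θ ≤ G g b - G g a := by
  have := h.isFiniteMeasure_law θ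
  have hsub : {x | θ ∈ Icc (l x) (u x)} ⊆ Icc (a + θ) (b + θ) ∪ {x | g (x - θ) = 0} := by
    intro x hx
    rcases (h.nonneg (x - θ)).eq_or_lt with h0 | h0
    · exact Or.inr h0.symm
    · have := hc (x - θ) h0 (by rwa [sub_add_cancel])
      exact Or.inl ⟨by linarith [this.1], by linarith [this.2]⟩
  calc coverage g l u θ ≤ (law g θ).real (Icc (a + θ) (b + θ) ∪ {x | g (x - θ) = 0}) :=
        measureReal_mono hsub
    _ ≤ (law g θ).real (Icc (a + θ) (b + θ)) + (law g θ).real {x | g (x - θ) = 0} :=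
        measureReal_union_le _ _
    _ = G g b - G g a := by
        rw [h.law_real_Icc θ hab, Measure.real, h.law_density_eq_zero, ENNReal.toReal_zero,
          add_zero]

/-- A lower bound on the coverage from the cdf conditions for `X - θ ∈ [-B, A]`. -/
lemma IsPDF.le_coverage_of_G (h : IsPDF g) (hu : IsUnimodalAtZero g) (hs : IsSymmetric g)
    {α θ A B : ℝ} {l u : ℝ → ℝ} (hα0 : 0 < α) (hα1 : α < 1) (hθ : 0 ≤ θ)
    (hI : ∀ x : ℝ, 0 < marginal g x → IsHPDInterval g α x (l x) (u x))
    (hA : 0 ≤ A) (hB : 0 ≤ B) (hGA : G g A < 1) (hGB : 0 < G g (-B))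
    (hcA : ∀ t, 0 ≤ t → t ≤ A → 2 * G g t - 1 ≤ (1 - α) * G g (t + θ))
    (hcB : ∀ s, 0 ≤ s → s ≤ B →
      G g (min s (θ - s)) - G g (-s) ≤ (1 - α) * G g (θ - s)) :
    G g A + G g B - 1 ≤ coverage g l u θ := by
  have e : G g A + G g B - 1 = G g A - G g (-B) := by rw [h.G_neg hs]; ring
  rw [e]
  refine h.le_coverage (by linarith) fun t ht => ?_
  have hx : 0 < G g (t + θ) := hGB.trans_le (h.G_mono (by linarith [ht.1]))
  rcases le_total 0 t with h0 | h0
  · have hg : 0 < g t := (h.pos_of_G_lt_one hu hs hA hGA).trans_le (hu.2 h0 hA ht.2)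
    rw [IsHPDInterval.mem_iff h hu hs hα0 hα1 hθ hg hx (hI _ (by rwa [marginal_eq_G])),
      abs_of_nonneg h0, min_eq_left (by linarith), h.G_neg hs]
    linarith [hcA t h0 ht.2]
  · have hg : 0 < g t := (h.pos_of_G_neg_pos hu hs hB hGB).trans_le (hu.le_of_abs_le hs (by
      rw [abs_of_nonpos h0, abs_of_nonneg hB]; linarith [ht.1]))
    rw [IsHPDInterval.mem_iff h hu hs hα0 hα1 hθ hg hx (hI _ (by rwa [marginal_eq_G])),
      abs_of_nonpos h0]
    have := hcB (-t) (by linarith) (by linarith [ht.1])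
    rwa [show θ - -t = t + θ by ring] at this

/-! ### Conditions for covering `θ` above and below -/

/-- For observations beyond `θ`, the condition for coverage is monotone. -/
lemma IsPDF.upper_condition_mono (h : IsPDF g) (hu : IsUnimodalAtZero g) {α θ s t : ℝ}
    (hα1 : α < 1) (hθ : 0 ≤ θ) (hs : 0 ≤ s) (hst : s ≤ t) :
    (1 + α) * (G g t - G g s) ≤
      (2 * G g t - 1 - (1 - α) * G g (t + θ)) - (2 * G g s - 1 - (1 - α) * G g (s + θ)) := by
  have h1 := h.G_shift_sub_le hu hs hst hθ
  nlinarith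

lemma IsLogConcave.continuousAt (hl : IsLogConcave g) {x : ℝ}
    (hx : x ∈ interior {x | 0 < g x}) : ContinuousAt g x := by
  have h1 := (ConcaveOn.continuousOn_interior hl).continuousAt (isOpen_interior.mem_nhds hx)
  refine (Real.continuous_exp.continuousAt.comp h1).congr ?_
  filter_upwards [isOpen_interior.mem_nhds hx] with y hy
  have hy' : y ∈ {x | 0 < g x} := interior_subset hy
  exact Real.exp_log hy'

/-- A strict form of the likelihood ratio comparison of the tails of a logconcave density. -/
lemma IsPDF.tail_lt (h : IsPDF g) (hu : IsUnimodalAtZero g) (hs : IsSymmetric g)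
    (hl : IsLogConcave g) {α d s : ℝ} (hα0 : 0 < α) (hα1 : α < 1) (hd : 0 < d)
    (hGd : G g (-d) = α * G g d) (hds : d < s) (hgs : 0 < g s) :
    G g (-s) < α * G g (2 * d - s) := by
  have hpos : ∀ r, |r| ≤ s → 0 < g r := fun r hr =>
    hgs.trans_le (hu.le_of_abs_le hs (hr.trans (le_abs_self s)))
  -- comparison from a pivot `r` at which the likelihood ratio is below `1 / α`
  have hlow : ∀ r, d < r → r ≤ s → α * g (2 * d - r) < g r →
      G g (-r) < α * G g (2 * d - r) := by
    intro r h1 h2 h3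
    have hr : 0 < g r := hpos r (by rw [abs_of_pos (by linarith)]; exact h2)
    have k1 := h.mul_G_shift_sub_le hl (p := -r) le_rfl (neg_le_neg h1.le)
      (show 0 ≤ 2 * d by linarith)
    rw [hs, show -d + 2 * d = d by ring, show -r + 2 * d = 2 * d - r by ring] at k1
    have k2 : G g (-r) < G g (-d) :=
      h.G_lt_of_pos hu hs (neg_lt_neg h1) hr (by simp)
        (by rw [abs_neg, abs_of_pos hd]; exact h1.le.trans (le_abs_self r))
    have k3 : g r * (α * (G g d - G g (2 * d - r))) < g r * (G g (-d) - G g (-r)) := by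
      nlinarith
    have k4 := lt_of_mul_lt_mul_left k3 hr.le
    linarith
  -- The ratio `g (x + 2d) / g x` decreases in `x`. If it is below `1 / α` at `-s`, it stays so on
  -- `[-s, -d]`, and subtracting that mass from `G (-d) = α G d` gives the claim. If it is above, it
  -- is so on all of `(-∞, -s]`, and the tails compare directly.
  rcases lt_trichotomy (α * g (2 * d - s)) (g s) with hlt | heq | hgt
  · exact hlow s hds le_rfl hlt
  · -- the ratio is continuous at `d`, where it is `1`
    have hopen : ∃ r, d < r ∧ r < s ∧ α * g (2 * d - r) < g r := by
      have hc : ContinuousAt g d := hl.continuousAt (mem_interior.2 ⟨Ioo (-s) s,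
        fun r hr => hpos r (abs_le.2 ⟨hr.1.le, hr.2.le⟩), isOpen_Ioo, by linarith, hds⟩)
      have hc' : ContinuousAt (fun r => α * g (2 * d - r)) d := by
        refine continuousAt_const.mul (ContinuousAt.comp (g := g) ?_ (by fun_prop))
        rwa [show 2 * d - d = d by ring]
      have hlt : α * g (2 * d - d) < g d := by
        rw [show 2 * d - d = d by ring]
        nlinarith [hpos d (by rw [abs_of_pos hd]; exact hds.le)]
      have hev : ∀ᶠ r in nhdsWithin d (Ioi d), α * g (2 * d - r) < g r :=
        (hc'.eventually_lt hc hlt).filter_mono nhdsWithin_le_nhds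
      obtain ⟨r, hr, hr'⟩ := (hev.and (Ioo_mem_nhdsGT hds)).exists
      exact ⟨r, hr'.1, hr'.2, hr⟩
    obtain ⟨r, h1, h2, h3⟩ := hopen
    have k1 := hlow r h1 h2.le h3
    have k2 := h.mul_G_shift_sub_le hl (p := -s) le_rfl (neg_le_neg h2.le)
      (show 0 ≤ 2 * d by linarith)
    rw [hs, show -r + 2 * d = 2 * d - r by ring, show -s + 2 * d = 2 * d - s by ring] at k2
    have k3 : g s * (α * (G g (2 * d - r) - G g (2 * d - s))) ≤ g s * (G g (-r) - G g (-s)) := by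
      rw [← heq] at k2 ⊢
      nlinarith
    have k4 := le_of_mul_le_mul_left k3 hgs
    linarith
  · have hG : 0 < G g (2 * d - s) := by
      refine (h.G_nonneg (-s)).trans_lt 
        (h.G_lt_of_pos hu hs (t := s) (by linarith) hgs (by simp) ?_)
      exact abs_le_abs (by linarith) (by linarith)
    have k1 := h.mul_G_le hl (p := -s) (c := 2 * d) (by linarith)
    rw [hs, show -s + 2 * d = 2 * d - s by ring] at k1
    rcases (h.G_nonneg (-s)).eq_or_lt with h0 | h0
    · rw [← h0]
      exact mul_pos hα0 hG
    · have k3 : g s * G g (-s) < g s * (α * G g (2 * d - s)) := by nlinarith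
      exact lt_of_mul_lt_mul_left k3 hgs.le

/-- Coverage condition at the observation `θ - s` for `s ≤ d` when the HPD interval is not
truncated at `0`. -/
lemma IsPDF.lower_condition_of_le (h : IsPDF g) (hs : IsSymmetric g) {α θ d s : ℝ}
    (hα0 : 0 < α) (hα1 : α < 1) (hGd : (1 + α) * G g d = 1) (hsθ : 2 * s ≤ θ) (hsd : s ≤ d) :
    G g (min s (θ - s)) - G g (-s) ≤ (1 - α) * G g (θ - s) := by
  rw [min_eq_left (by linarith), h.G_neg hs]
  have h1 : G g s ≤ G g (θ - s) := h.G_mono (by linarith)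
  have h2 := h.G_mono hsd
  nlinarith

/-- Coverage condition at the observation `θ - s` when the HPD interval is truncated at `0`; it is
inherited from any `b ≥ s`. -/
lemma IsPDF.lower_condition_of_ratio (h : IsPDF g) (hs : IsSymmetric g)
    (hu : IsUnimodalAtZero g) (hl : IsLogConcave g) {α θ b s : ℝ} (hα0 : 0 < α) (hθ : 0 ≤ θ)
    (hb : 0 ≤ b) (hGb : 0 < G g (-b)) (hle : α * G g (θ - b) ≤ G g (-b)) (hsb : s ≤ b)
    (hsθ : θ ≤ 2 * s) :
    G g (min s (θ - s)) - G g (-s) ≤ (1 - α) * G g (θ - s) := by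
  rw [min_eq_right (by linarith)]
  have hg : 0 < g (-b) := by rw [hs]; exact h.pos_of_G_neg_pos hu hs hb hGb
  have h1 := h.G_mul_shift_le hl hg (neg_le_neg hsb) hθ
  rw [show -s + θ = θ - s by ring, show -b + θ = θ - b by ring] at h1
  have h2 := h.G_nonneg (-s)
  have h3 : G g (-b) * (α * G g (θ - s)) ≤ G g (-b) * G g (-s) := by nlinarith
  have h4 := le_of_mul_le_mul_left h3 hGb
  linarith

/-! ### Comparison of the coverage at `2d` with all others -/

/-- The likelihood ratio bound which drives the comparison of coverages. -/
lemma IsPDF.density_ratio_le (h : IsPDF g) (hs : IsSymmetric g) (hu : IsUnimodalAtZero g)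
    {α d : ℝ} (hα0 : 0 < α) (hα1 : α < 1) (hd : 0 < d) (hGd : (1 + α) * G g d = 1) :
    (1 - α) * g (2 * d) ≤ 2 * α * g 0 := by
  -- Rectangles of width `d`: one under `g` on `[d, 2d]`, with area at most `1 - G d = α / (1 + α)`,
  -- and one over `g` on `[0, d]`, with area at least `G d - 1/2 = (1 - α) / (2 (1 + α))`.
  have h1 : d * g (2 * d) ≤ G g (2 * d) - G g d := by
    rw [h.G_sub]
    have := intervalIntegral.integral_mono_on (μ := volume) (show d ≤ 2 * d by linarith)
      (intervalIntegrable_const (c := g (2 * d))) (h.intervalIntegrable _ _)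
      (fun x hx => hu.2 (mem_Ici.2 (hd.le.trans hx.1)) (mem_Ici.2 (by linarith)) hx.2)
    rw [intervalIntegral.integral_const, smul_eq_mul] at this
    linarith
  have h2 : G g d - G g 0 ≤ d * g 0 := by
    rw [h.G_sub]
    have := intervalIntegral.integral_mono_on (μ := volume) hd.le
      (h.intervalIntegrable _ _) (intervalIntegrable_const (c := g 0))
      (fun x hx => hu.2 (mem_Ici.2 le_rfl) (mem_Ici.2 hx.1) hx.1)
    rw [intervalIntegral.integral_const, smul_eq_mul] at this
    linarith
  rw [h.G_zero hs] at h2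
  have h3 := h.G_le_one (2 * d)
  have h4 : (1 + α) * (d * ((1 - α) * g (2 * d))) ≤ (1 + α) * (d * (2 * α * g 0)) := by
    have e1 : (1 + α) * (d * g (2 * d)) ≤ α := by nlinarith
    have e2 : (1 - α) / 2 ≤ (1 + α) * (d * g 0) := by nlinarith
    nlinarith
  exact le_of_mul_le_mul_left (le_of_mul_le_mul_left h4 (by linarith)) hd

/-- The change of the upper tail between the parameter values `θ` and `2d` is dominated by the
change of the lower tail. -/
lemma IsPDF.upper_tail_change_le (h : IsPDF g) (hs : IsSymmetric g) (hu : IsUnimodalAtZero g)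
    (hl : IsLogConcave g) {α d θ a v b : ℝ} (hα0 : 0 < α) (hα1 : α < 1) (hd : 0 < d)
    (hGd : (1 + α) * G g d = 1) (hdv : d ≤ v) (hva : v ≤ a) (hdb : d ≤ b) (hbθ : b ≤ θ)
    (hθd : θ ≤ 2 * d) (hGb : α * G g (θ - b) = 1 - G g b)
    (hGv : G g a - G g v = G g b - G g d) :
    (1 - α) * (G g (a + 2 * d) - G g (v + θ)) ≤ 2 * (G g b - G g d) := by
  have hg0 := h.pos_zero hu hs
  have hratio := h.density_ratio_le hs hu hα0 hα1 hd hGd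
  have k1 := h.mul_G_shift_sub_le hl (p := 0) (hd.le.trans hdv) hva (show 0 ≤ 2 * d by linarith)
  have k2 := h.mul_G_shift_sub_le hl (p := 0) (a := θ - d) (b := d) (by linarith) (by linarith)
    (show 0 ≤ 2 * d by linarith)
  rw [zero_add] at k1 k2
  have k3 := h.G_shift_sub_le hu (a := θ - d + 2 * d) (b := d + 2 * d) (c := v - d)
    (by linarith) (by linarith) (by linarith)
  rw [show d + 2 * d + (v - d) = v + 2 * d by ring,
    show θ - d + 2 * d + (v - d) = v + θ by ring] at k3
  have k4 := h.G_shift_sub_le hu (a := θ - b) (b := θ - d) (c := d - (θ - b))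
    (by linarith) (by linarith) (by linarith)
  rw [show θ - d + (d - (θ - b)) = b by ring, show θ - b + (d - (θ - b)) = d by ring] at k4
  set δ := G g b - G g d with hδ
  have hδ0 : 0 ≤ δ := sub_nonneg.2 (h.G_mono hdb)
  have hδα : α * (G g d - G g (θ - b)) = δ := by rw [hδ]; linarith
  -- The change splits at `v + 2d`. Up to the factor `g (2d) / g 0`, one piece is at most `G b - G d
  -- ≤ G (θ - d) - G (θ - b)` and the other at most `G d - G (θ - d)`, so the bounds telescope.
  have m1 : g 0 * (G g (a + 2 * d) - G g (v + θ)) ≤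
      g (2 * d) * (G g d - G g (θ - b)) := by
    have := mul_le_mul_of_nonneg_left k3 hg0.le
    have := mul_le_mul_of_nonneg_left k4 (h.nonneg (2 * d))
    rw [hGv] at k1
    linarith
  have hD : 0 ≤ G g d - G g (θ - b) := by
    refine sub_nonneg.2 (h.G_mono (by linarith))
  have m2 : g 0 * ((1 - α) * (G g (a + 2 * d) - G g (v + θ))) ≤ g 0 * (2 * δ) := by
    have e1 := mul_le_mul_of_nonneg_left m1 (show 0 ≤ 1 - α by linarith)
    have e2 := mul_le_mul_of_nonneg_right hratio hD
    rw [← hδα]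
    linarith
  exact le_of_mul_le_mul_left m2 hg0

/-- The coverage at `2d` is at most `G a + G d - 1`, a lower bound on all coverages. -/
lemma IsPDF.coverage_bounds (h : IsPDF g) (hs : IsSymmetric g) (hu : IsUnimodalAtZero g)
    (hl : IsLogConcave g) {α d a : ℝ} (hα0 : 0 < α) (hα1 : α < 1) (hd : 0 < d)
    (hGd : (1 + α) * G g d = 1) (hda : d ≤ a)
    (hGa : 2 * G g a - 1 = (1 - α) * G g (a + 2 * d)) {l u : ℝ → ℝ}
    (hI : ∀ x : ℝ, 0 < marginal g x → IsHPDInterval g α x (l x) (u x)) :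
    coverage g l u (2 * d) ≤ G g a + G g d - 1 ∧
      ∀ θ, 0 ≤ θ → G g a + G g d - 1 ≤ coverage g l u θ := by
  have hGd1 : G g d < 1 := by nlinarith
  have hGd' : G g (-d) = α * G g d := by rw [h.G_neg hs]; linarith
  have hGdpos : 0 < G g d := by nlinarith
  have hGa2 : G g a ≤ 1 - α / 2 := by nlinarith [h.G_le_one (a + 2 * d)]
  have hA : ∀ θ, 0 ≤ θ → ∀ t, 0 ≤ t → t ≤ d → 2 * G g t - 1 ≤ (1 - α) * G g (t + θ) := by
    intro θ hθ t _ htd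
    have h1 := h.G_mono htd
    have h2 : G g t ≤ G g (t + θ) := h.G_mono (by linarith)
    nlinarith
  refine ⟨?_, fun θ hθ => ?_⟩
  · have e : G g a + G g d - 1 = G g a - G g (-d) := by rw [h.G_neg hs]; ring
    rw [e]
    refine h.coverage_le (by linarith) fun t ht hmem => ?_
    have hx : 0 < G g (t + 2 * d) := by
      -- The `min` keeps the right endpoint inside `[-|t|, |t|]`, where `g` is positive, and at most
      -- `t + 2d`.
      have h1 : G g (-|t|) < G g (-|t| + min (2 * |t|) (2 * d)) ∨ t = 0 := by
        rcases eq_or_ne t 0 with h0 | h0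
        · exact Or.inr h0
        · have h0' := abs_pos.2 h0
          have h1 : 0 < min (2 * |t|) (2 * d) := lt_min (by linarith) (by linarith)
          refine Or.inl (h.G_lt_of_pos hu hs (t := t) (by linarith) ht (by simp) ?_)
          exact abs_le.2 ⟨by linarith, by linarith [min_le_left (2 * |t|) (2 * d)]⟩
      rcases h1 with h1 | h1
      · refine ((h.G_nonneg _).trans_lt h1).trans_le (h.G_mono ?_)
        linarith [min_le_right (2 * |t|) (2 * d), neg_abs_le t]
      · exact hGdpos.trans_le (h.G_mono (by rw [h1]; linarith))
    rw [IsHPDInterval.mem_iff h hu hs hα0 hα1 (by linarith) ht hx (hI _ (by rwa [marginal_eq_G]))]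
      at hmem
    constructor
    · by_contra! htd
      rw [abs_of_neg (by linarith), min_eq_right (by linarith)] at hmem
      have := h.tail_lt hu hs hl hα0 hα1 hd hGd' (s := -t) (by linarith) (by rwa [hs])
      rw [show 2 * d - -t = t + 2 * d by ring] at this
      linarith
    · by_contra! hat
      have ha0 : 0 ≤ a := by linarith
      rw [abs_of_nonneg (by linarith), min_eq_left (by linarith), h.G_neg hs] at hmem
      have h1 := h.upper_condition_mono hu hα1 (show 0 ≤ 2 * d by linarith) ha0 hat.le
      have h2 := h.G_lt_of_pos hu hs hat ht
        (by rw [abs_of_nonneg ha0]; exact hat.le.trans (le_abs_self t)) le_rfl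
      nlinarith
  rcases le_or_gt (2 * d) θ with hθd | hθd
  · refine h.le_coverage_of_G hu hs hα0 hα1 hθ hI (hd.le.trans hda) hd.le (by linarith)
      (by rw [hGd']; positivity) (fun t ht0 hta => ?_) (fun s _ hsd => ?_)
    · have h1 := h.upper_condition_mono hu hα1 (show 0 ≤ 2 * d by linarith) ht0 hta
      have h2 := h.G_mono hta
      have h3 : G g (t + 2 * d) ≤ G g (t + θ) := h.G_mono (by linarith)
      nlinarith
    · exact h.lower_condition_of_le hs hα0 hα1 hGd (by linarith) hsd
  -- Since `G (-c) = α / 2 = α G 0`, the lower limit may be taken as `-c` whenever `θ ≤ c`. Then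
  -- `[-c, d]` already suffices, because `G a ≤ 1 - α / 2 = G c`.
  obtain ⟨c, hdc, hGc⟩ := h.exists_G_eq (p := 1 - α / 2) (a := d) (by nlinarith) (by linarith)
  have hGc' : G g (-c) = α / 2 := by rw [h.G_neg hs]; linarith
  have hG0 := h.G_zero hs
  have hB : ∀ b, 0 ≤ b → 0 < G g (-b) → α * G g (θ - b) ≤ G g (-b) → ∀ s, 0 ≤ s → s ≤ b →
      G g (min s (θ - s)) - G g (-s) ≤ (1 - α) * G g (θ - s) := by
    intro b hb hGb hle s _ hsb
    rcases le_total (2 * s) θ with h1 | h1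
    · exact h.lower_condition_of_le hs hα0 hα1 hGd h1 (by linarith)
    · exact h.lower_condition_of_ratio hs hu hl hα0 hθ hb hGb hle hsb h1
  rcases le_or_gt θ c with hθc | hcθ
  · have h1 : G g (θ - c) ≤ G g 0 := h.G_mono (by linarith)
    have h2 := h.le_coverage_of_G hu hs hα0 hα1 hθ hI hd.le (hd.le.trans hdc) hGd1
      (by rw [hGc']; positivity) (hA θ hθ)
      (hB c (hd.le.trans hdc) (by rw [hGc']; positivity) (by rw [hGc']; nlinarith))
    linarith
  have hcont : Continuous fun b => α * G g (θ - b) + G g b :=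
    (continuous_const.mul (h.G_continuous.comp (continuous_const.sub continuous_id))).add
      h.G_continuous
  -- `b` turns the truncated lower condition `α G (θ - b) ≤ G (-b)` into an equality.
  obtain ⟨b, hb, hGb⟩ := intermediate_value_Icc hdc hcont.continuousOn
    (show (1 : ℝ) ∈ Icc _ _ from by
      have h1 : G g (θ - d) ≤ G g d := h.G_mono (by linarith)
      have h2 : G g 0 ≤ G g (θ - c) := h.G_mono (by linarith)
      constructor <;> nlinarith)
  simp only at hGb
  have hGb1 : G g b ≤ 1 - α / 2 := hGc ▸ h.G_mono hb.2
  have hGbpos : 0 < G g (-b) := by rw [h.G_neg hs]; linarith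
  have hb0 : 0 ≤ b := hd.le.trans hb.1
  have hBb := hB b hb0 hGbpos (by rw [h.G_neg hs]; linarith)
  have hδ0 : G g d ≤ G g b := h.G_mono hb.1
  rcases le_total (G g a - (G g b - G g d)) (G g d) with hcase | hcase
  · have h2 := h.le_coverage_of_G hu hs hα0 hα1 hθ hI hd.le hb0 hGd1 hGbpos (hA θ hθ) hBb
    linarith
  -- `v` gives up above exactly the probability that `b` gains below, so `G v + G b = G a + G d`. It
  -- remains to see that `v` meets the upper condition at `θ`.
  · obtain ⟨v, hv, hGv⟩ := intermediate_value_Icc hda h.G_continuous.continuousOn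
      (show G g a - (G g b - G g d) ∈ Icc (G g d) (G g a) from ⟨hcase, by linarith⟩)
    have hv0 : 0 ≤ v := hd.le.trans hv.1
    have key := h.upper_tail_change_le hs hu hl hα0 hα1 hd hGd hv.1 hv.2 hb.1
      (by linarith [hb.2]) hθd.le (by linarith) (by linarith)
    have h2 := h.le_coverage_of_G hu hs hα0 hα1 hθ hI hv0 hb0 (by linarith) hGbpos
      (fun t ht0 htv => by
        have h1 := h.upper_condition_mono hu hα1 hθ ht0 htv
        have h2 := h.G_mono htv
        nlinarith) hBb
    linarith

/-! ### The upper limit at `2d` and the bound `1 - 3α/2` -/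

lemma IsPDF.exists_upper_limit (h : IsPDF g) {α d : ℝ} (hα0 : 0 < α) (hα1 : α < 1)
    (hd : 0 < d) (hGd : (1 + α) * G g d = 1) :
    ∃ a, d ≤ a ∧ 2 * G g a - 1 = (1 - α) * G g (a + 2 * d) := by
  -- At `R` the left side `2 G R - 1` equals `1 - α`, the largest value the right side can have.
  obtain ⟨R, hR, hGR⟩ := h.exists_G_eq (p := 1 - α / 2) (a := d) (by nlinarith) (by linarith)
  have hcont : Continuous fun t => 2 * G g t - 1 - (1 - α) * G g (t + 2 * d) :=
    ((continuous_const.mul h.G_continuous).sub continuous_const).sub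
      (continuous_const.mul (h.G_continuous.comp (continuous_id.add continuous_const)))
  obtain ⟨a, ha, ha'⟩ := intermediate_value_Icc hR hcont.continuousOn
    (show (0 : ℝ) ∈ Icc _ _ from by
      have h1 : G g d ≤ G g (d + 2 * d) := h.G_mono (by linarith)
      have h2 := h.G_le_one (R + 2 * d)
      constructor <;> nlinarith)
  exact ⟨a, ha.1, by linarith⟩

lemma IsPDF.lower_bound (h : IsPDF g) (hs : IsSymmetric g) (hu : IsUnimodalAtZero g)
    (hl : IsLogConcave g) {α d a : ℝ} (hα0 : 0 < α) (hα1 : α < 1) (hd : 0 < d)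
    (hGd : (1 + α) * G g d = 1) (hda : d ≤ a)
    (hGa : 2 * G g a - 1 = (1 - α) * G g (a + 2 * d)) :
    1 - 3 * α / 2 ≤ G g a + G g d - 1 := by
  have htail : G g (-(2 * d)) ≤ 2 * G g (-d) ^ 2 := by
    rcases (h.G_nonneg (-(2 * d))).eq_or_lt with h0 | h0
    · rw [← h0]
      positivity
    · have hg : 0 < g (-(2 * d)) := by
        rw [hs]
        exact h.pos_of_G_neg_pos hu hs (by linarith) h0
      -- Logconcavity of `G` at the equally spaced points `-2d, -d, 0`, with `G 0 = 1/2`.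
      have := h.G_mul_shift_le hl hg (q := -d) (by linarith) hd.le
      rw [neg_add_cancel, h.G_zero hs, show -(2 * d) + d = -d by ring] at this
      linarith
  have h1 : G g (2 * d) ≤ G g (a + 2 * d) := h.G_mono (by linarith)
  rw [h.G_neg hs, h.G_neg hs] at htail
  have hp : G g d = 1 / (1 + α) := by
    rw [eq_div_iff (by linarith)]
    linarith
  have h2 : 1 - 2 * (1 - G g d) ^ 2 ≤ G g (a + 2 * d) := by linarith
  have h3 : (1 - α) * (1 - 2 * (1 - G g d) ^ 2) ≤ 2 * G g a - 1 := by
    rw [hGa]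
    exact mul_le_mul_of_nonneg_left h2 (by linarith)
  have h4 : 3 - 3 * α ≤ (1 - α) * (1 - 2 * (1 - G g d) ^ 2) + 2 * G g d := by
    rw [hp]
    have hα : 0 < 1 + α := by linarith
    have e : (1 - α) * (1 - 2 * (1 - 1 / (1 + α)) ^ 2) + 2 * (1 / (1 + α)) - (3 - 3 * α)
        = 4 * α ^ 3 / (1 + α) ^ 2 := by
      field_simp
      ring
    have : 0 ≤ 4 * α ^ 3 / (1 + α) ^ 2 := by positivity
    linarith
  linarith

end LowerBoundedLocation

open LowerBoundedLocation in
theorem corollary3 (g : ℝ → ℝ) (α : ℝ) (hα0 : 0 < α) (hα1 : α < 1)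
    (hpdf : IsPDF g) (huni : IsUnimodalAtZero g) (hsymm : IsSymmetric g)
    (hlog : IsLogConcave g) :
    (∀ x : ℝ, 0 < marginal g x → ∃! I : ℝ × ℝ, IsHPDInterval g α x I.1 I.2) ∧
    ∀ (l u : ℝ → ℝ), (∀ x : ℝ, 0 < marginal g x → IsHPDInterval g α x (l x) (u x)) →
      ∀ d₀ : ℝ, d₀ = invG g (1 / (1 + α)) →
        0 ≤ 2 * d₀ ∧
        (∀ θ : ℝ, 0 ≤ θ → coverage g l u (2 * d₀) ≤ coverage g l u θ) ∧
        1 - 3 * α / 2 ≤ coverage g l u (2 * d₀) := by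
  refine ⟨fun x hx => hpdf.existsUnique_isHPDInterval huni hsymm hα0 hα1
    (by rwa [marginal_eq_G] at hx), ?_⟩
  rintro l u hI d₀ rfl
  have hα : 0 < 1 + α := by linarith
  obtain ⟨hd, hG⟩ := hpdf.invG_spec (p := 1 / (1 + α))
    (by rw [hpdf.G_zero hsymm, one_div_lt_one_div two_pos hα]; linarith)
    (by rw [div_lt_one hα]; linarith)
  rw [eq_div_iff hα.ne', mul_comm] at hG
  obtain ⟨a, hda, hGa⟩ := hpdf.exists_upper_limit hα0 hα1 hd hG
  obtain ⟨hle, hge⟩ := hpdf.coverage_bounds hsymm huni hlog hα0 hα1 hd hG hda hGa hI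
  exact ⟨by linarith, fun θ hθ => hle.trans (hge θ hθ),
    (hpdf.lower_bound hsymm huni hlog hα0 hα1 hd hG hda hGa).trans (hge _ (by linarith))⟩
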